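/- Let $(\Omega,\mu)$ be a $\sigma$-finite measure space with $\mu$ non-atomic, and let $\mathcal M(\Omega,\mu)$ be the space of (a.e. classes of) $\mu$-measurable scalar functions, real or complex. For $f\in\mathcal M(\Omega,\mu)$ let $f^*(t)=\inf\{\lambda\ge 0:\mu\{|f|>\lambda\}\le t\}$ be its non-increasing rearrangement and $f^{**}(t)=\frac1t\int_0^t f^*(u)\,du$, $t>0$. Let $L_{1,\infty}$ have the quasi-norm $\sup_{t>0}t f^*(t)$. A positive Lebesgue measurable function $b$ on $(0,\infty)$ is slowly varying, $b\in SV$, if for every $\varepsilon>0$ the function $t^{\varepsilon}b(t)$ is equivalent to an increasing function and $t^{-\varepsilon}b(t)$ is equivalent to a decreasing function (two positive functions are equivalent if each is at most a constant times the other). Write $\|\cdot\|_{q,I}$ for the (quasi-)norm of $L_q(I)$ on an interval $I\subset(0,\infty)$, with $1/\infty=0$. Given $\gamma\in\mathbb R$, $0<q,r,s\le\infty$, $a,b,c\in SV$ and a measurable $g:(0,\infty)\to[0,\infty]$, put $$N^{\mathcal{LL}}_\gamma(g)=\Big\|t^{-\frac1s}c(t)\big\|u^{-\frac1r}b(u)\|v^{\gamma-\frac1q}a(v)g(v)\|_{q,(0,u)}\big\|_{r,(0,t)}\Big\|_{s,(0,\infty)},$$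 $$N^{\mathcal{RR}}_\gamma(g)=\Big\|t^{-\frac1s}c(t)\big\|u^{-\frac1r}b(u)\|v^{\gamma-\frac1q}a(v)g(v)\|_{q,(u,\infty)}\big\|_{r,(t,\infty)}\Big\|_{s,(0,\infty)}.$$ Let $K(t,f;A_0,A_1)=\inf\{\|f_0\|_{A_0}+t\|f_1\|_{A_1}: f=f_0+f_1,\ f_i\in A_i\}$ be Peetre's $K$-functional. For $X\in\{\mathcal{LL},\mathcal{RR}\}$, let $(A_0,A_1)^{X}_{\theta,s,c,r,b,q,a}$ be the space of all $f\in A_0+A_1$ with $\|f\|:=N^{X}_{-\theta}(K(\cdot,f;A_0,A_1))<\infty$, let $L^{X}_{p,(s,c,r,b,q,a)}$ be the space of all $f\in\mathcal M(\Omega,\mu)$ with $\|f\|:=N^{X}_{1/p}(f^*)<\infty$, and let $(L)^{X}_{p,(s,c,r,b,q,a)}$ be the space of all $f\in\mathcal M(\Omega,\mu)$ with $\|f\|:=N^{X}_{1/p}(f^{**})<\infty$. **Theorem.** Let $0<\theta\le1$, $p=\frac1{1-\theta}$ (so $p=\infty$ if $\theta=1$), $0<q,r,s\le\infty$ and $a,b,c\in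 SV$. Then $$(L_1,L_\infty)^{\mathcal{LL}}_{\theta,s,c,r,b,q,a}=(L_{1,\infty},L_\infty)^{\mathcal{LL}}_{\theta,s,c,r,b,q,a}=(L)^{\mathcal{LL}}_{p,(s,c,r,b,q,a)}=L^{\mathcal{LL}}_{p,(s,c,r,b,q,a)}$$ and $$(L_1,L_\infty)^{\mathcal{RR}}_{\theta,s,c,r,b,q,a}=(L_{1,\infty},L_\infty)^{\mathcal{RR}}_{\theta,s,c,r,b,q,a}=(L)^{\mathcal{RR}}_{p,(s,c,r,b,q,a)}=L^{\mathcal{RR}}_{p,(s,c,r,b,q,a)},$$ where equality means that the spaces have the same elements and that their quasi-norms are equivalent (each is at most a constant, independent of $f$, times the other). -/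

import Mathlib

open MeasureTheory Set
open scoped ENNReal NNReal

namespace LorentzKaramata

noncomputable section

/-- Slowly varying functions on `(0,∞)`: positive, Lebesgue measurable, and for every `ε > 0` the
function `t ^ ε * b t` is equivalent to an increasing function on `(0,∞)` and `t ^ (-ε) * b t` is
equivalent to a decreasing one. Values outside `(0,∞)` are irrelevant. -/
structure SlowlyVarying (b : ℝ → ℝ) : Prop where
  pos : ∀ t, 0 < t → 0 < b t
  measurable : AEMeasurable b (volume.restrict (Ioi 0))
  equiv_increasing : ∀ ε : ℝ, 0 < ε → ∃ g : ℝ → ℝ, MonotoneOn g (Ioi 0) ∧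
    ∃ C : ℝ, 0 < C ∧ ∀ t, 0 < t → g t ≤ C * (t ^ ε * b t) ∧ t ^ ε * b t ≤ C * g t
  equiv_decreasing : ∀ ε : ℝ, 0 < ε → ∃ g : ℝ → ℝ, AntitoneOn g (Ioi 0) ∧
    ∃ C : ℝ, 0 < C ∧ ∀ t, 0 < t → g t ≤ C * (t ^ (-ε) * b t) ∧ t ^ (-ε) * b t ≤ C * g t

/-- `μ` has no atoms, in the measure-theoretic sense: every measurable set of positive measure has
a measurable subset of positive, strictly smaller measure. -/
def Nonatomic {Ω : Type*} [MeasurableSpace Ω] (μ : Measure Ω) : Prop :=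
  ∀ s, MeasurableSet s → 0 < μ s → ∃ t, t ⊆ s ∧ MeasurableSet t ∧ 0 < μ t ∧ μ t < μ s

/-- The weighted (quasi-)norm `‖t ^ (γ - 1/q) b(t) g(t)‖_{q, I}` of the Lebesgue space `L_q(I)`,
`I ⊆ (0,∞)`, `0 < q ≤ ∞`, with `1/∞ = 0`. -/
def weightedNorm (γ : ℝ) (b : ℝ → ℝ) (q : ℝ≥0∞) (I : Set ℝ) (g : ℝ → ℝ≥0∞) : ℝ≥0∞ :=
  eLpNorm (fun t => ENNReal.ofReal (t ^ (γ - (q⁻¹).toReal) * b t) * g t) q (volume.restrict I)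

/-- `‖t^{-1/s} c(t) ‖u^{-1/r} b(u) ‖v^{γ-1/q} a(v) g(v)‖_{q,(0,u)}‖_{r,(0,t)}‖_{s,(0,∞)}`. -/
def normLL (γ : ℝ) (s : ℝ≥0∞) (c : ℝ → ℝ) (r : ℝ≥0∞) (b : ℝ → ℝ) (q : ℝ≥0∞) (a : ℝ → ℝ)
    (g : ℝ → ℝ≥0∞) : ℝ≥0∞ :=
  weightedNorm 0 c s (Ioi 0) fun t =>
    weightedNorm 0 b r (Ioo 0 t) fun u => weightedNorm γ a q (Ioo 0 u) g

/-- `‖t^{-1/s} c(t) ‖u^{-1/r} b(u) ‖v^{γ-1/q} a(v) g(v)‖_{q,(u,∞)}‖_{r,(t,∞)}‖_{s,(0,∞)}`. -/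
def normRR (γ : ℝ) (s : ℝ≥0∞) (c : ℝ → ℝ) (r : ℝ≥0∞) (b : ℝ → ℝ) (q : ℝ≥0∞) (a : ℝ → ℝ)
    (g : ℝ → ℝ≥0∞) : ℝ≥0∞ :=
  weightedNorm 0 c s (Ioi 0) fun t =>
    weightedNorm 0 b r (Ioi t) fun u => weightedNorm γ a q (Ioi u) g

/-- A (quasi-)normed space of elements of `E`: its set of elements together with its (quasi-)norm
(only the values on the elements matter). -/
structure Space (E : Type*) where
  elements : Set E
  qnorm : E → ℝ≥0∞

/-- Continuous embedding `X ⊂ Y`. -/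
def Space.Embeds {E : Type*} (X Y : Space E) : Prop :=
  X.elements ⊆ Y.elements ∧ ∃ C : ℝ≥0, ∀ f ∈ X.elements, Y.qnorm f ≤ C * X.qnorm f

/-- Equality of (quasi-)normed spaces: the same elements and equivalent (quasi-)norms. -/
def Space.Same {E : Type*} (X Y : Space E) : Prop :=
  X.Embeds Y ∧ Y.Embeds X

/-- The space of all elements of `E` at which the functional `N` is finite. -/
def Space.ofFunctional {E : Type*} (N : E → ℝ≥0∞) : Space E where
  elements := {f | N f < ∞}
  qnorm := N

section Interpolation

variable {E : Type*} [AddCommGroup E]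

/-- The elements of `A₀ + A₁`. -/
def sumElements (A₀ A₁ : Space E) : Set E :=
  {f | ∃ f₀ ∈ A₀.elements, ∃ f₁ ∈ A₁.elements, f = f₀ + f₁}

/-- Peetre's `K`-functional `K(t, f; A₀, A₁)`, `t > 0`. -/
def peetreK (A₀ A₁ : Space E) (f : E) (t : ℝ) : ℝ≥0∞ :=
  ⨅ (f₀ : E) (_ : f₀ ∈ A₀.elements) (f₁ : E) (_ : f₁ ∈ A₁.elements) (_ : f = f₀ + f₁),
    A₀.qnorm f₀ + ENNReal.ofReal t * A₁.qnorm f₁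

/-- The extremal interpolation space `(A₀, A₁)^{𝓛,𝓛}_{θ,s,c,r,b,q,a}`. -/
def interpLL (A₀ A₁ : Space E) (θ : ℝ) (s : ℝ≥0∞) (c : ℝ → ℝ) (r : ℝ≥0∞) (b : ℝ → ℝ)
    (q : ℝ≥0∞) (a : ℝ → ℝ) : Space E where
  elements := {f | f ∈ sumElements A₀ A₁ ∧ normLL (-θ) s c r b q a (peetreK A₀ A₁ f) < ∞}
  qnorm f := normLL (-θ) s c r b q a (peetreK A₀ A₁ f)

/-- The extremal interpolation space `(A₀, A₁)^{𝓡,𝓡}_{θ,s,c,r,b,q,a}`. -/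
def interpRR (A₀ A₁ : Space E) (θ : ℝ) (s : ℝ≥0∞) (c : ℝ → ℝ) (r : ℝ≥0∞) (b : ℝ → ℝ)
    (q : ℝ≥0∞) (a : ℝ → ℝ) : Space E where
  elements := {f | f ∈ sumElements A₀ A₁ ∧ normRR (-θ) s c r b q a (peetreK A₀ A₁ f) < ∞}
  qnorm f := normRR (-θ) s c r b q a (peetreK A₀ A₁ f)

end Interpolation

section FunctionSpaces

variable {Ω : Type*} [MeasurableSpace Ω] {μ : Measure Ω} {𝕜 : Type*} [RCLike 𝕜]

/-- Non-increasing rearrangement `f*(t) = inf {λ ≥ 0 : μ {|f| > λ} ≤ t}`, `inf ∅ = ∞`. -/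
def rearrangement (f : Ω →ₘ[μ] 𝕜) (t : ℝ) : ℝ≥0∞ :=
  sInf {l : ℝ≥0∞ | μ {x | l < ‖f x‖ₑ} ≤ ENNReal.ofReal t}

/-- Maximal function `f**(t) = t⁻¹ ∫₀ᵗ f*(u) du`, `t > 0`. -/
def maximalRearrangement (f : Ω →ₘ[μ] 𝕜) (t : ℝ) : ℝ≥0∞ :=
  (ENNReal.ofReal t)⁻¹ * ∫⁻ u in Ioo 0 t, rearrangement f u

variable (μ 𝕜)

/-- The Lebesgue space `L_p(Ω, μ)`. -/
def lebesgueSpace (p : ℝ≥0∞) : Space (Ω →ₘ[μ] 𝕜) :=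
  Space.ofFunctional fun f => eLpNorm f p μ

/-- The weak space `L_{1,∞}(Ω, μ)`, with quasi-norm `sup_{t>0} t f*(t)`. -/
def weakL1 : Space (Ω →ₘ[μ] 𝕜) :=
  Space.ofFunctional fun f => ⨆ (t : ℝ) (_ : 0 < t), ENNReal.ofReal t * rearrangement f t

/-- `L^{𝓛,𝓛}_{p,(s,c,r,b,q,a)}`, defined through `f*`. -/
def lorentzLL (p s : ℝ≥0∞) (c : ℝ → ℝ) (r : ℝ≥0∞) (b : ℝ → ℝ) (q : ℝ≥0∞) (a : ℝ → ℝ) :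
    Space (Ω →ₘ[μ] 𝕜) :=
  Space.ofFunctional fun f => normLL (p⁻¹).toReal s c r b q a (rearrangement f)

/-- `(L)^{𝓛,𝓛}_{p,(s,c,r,b,q,a)}`, defined through `f**`. -/
def lorentzMaxLL (p s : ℝ≥0∞) (c : ℝ → ℝ) (r : ℝ≥0∞) (b : ℝ → ℝ) (q : ℝ≥0∞) (a : ℝ → ℝ) :
    Space (Ω →ₘ[μ] 𝕜) :=
  Space.ofFunctional fun f => normLL (p⁻¹).toReal s c r b q a (maximalRearrangement f)

/-- `L^{𝓡,𝓡}_{p,(s,c,r,b,q,a)}`, defined through `f*`. -/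
def lorentzRR (p s : ℝ≥0∞) (c : ℝ → ℝ) (r : ℝ≥0∞) (b : ℝ → ℝ) (q : ℝ≥0∞) (a : ℝ → ℝ) :
    Space (Ω →ₘ[μ] 𝕜) :=
  Space.ofFunctional fun f => normRR (p⁻¹).toReal s c r b q a (rearrangement f)

/-- `(L)^{𝓡,𝓡}_{p,(s,c,r,b,q,a)}`, defined through `f**`. -/
def lorentzMaxRR (p s : ℝ≥0∞) (c : ℝ → ℝ) (r : ℝ≥0∞) (b : ℝ → ℝ) (q : ℝ≥0∞) (a : ℝ → ℝ) :
    Space (Ω →ₘ[μ] 𝕜) :=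
  Space.ofFunctional fun f => normRR (p⁻¹).toReal s c r b q a (maximalRearrangement f)

end FunctionSpaces

end

end LorentzKaramata

namespace LorentzKaramata

/-! The two cases differ only in the intervals, (0,u) or (u,∞), over which the inner norms run. Both
families are monotone and compatible with dilations, and nothing else about them is needed beyond
measurability and positive length, so `nestedNorm` treats them together.

Pointwise, t f*(t) ≤ K(t,f;L_{1,∞},L_∞) ≤ K(t,f;L_1,L_∞) ≤ 2t f**(t). The first bound holds because
adding a bounded function raises f* by at most its supremum (`rearrangement_add_le`), the second is
Chebyshev's inequality (`weakL1_qnorm_le`), the third comes from truncating f at height f*(t)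
(`exists_decomposition`). The factor t turns the exponent -θ into 1-θ = 1/p
(`nestedNorm_ofReal_mul`).

A cycle of embeddings then closes once f** is controlled by f* in norm, a Hardy inequality
(`exists_nestedNorm_dyadic_le`). Cutting (0,t) dyadically bounds f**(t) by Σ l f*(lt) over l =
2^{-(k+1)}. A dilation by l costs l^{-(1-θ)} up to an arbitrarily small power of l, so the k-th term
decays geometrically because θ > 0. This decay pays for a quasi-triangle inequality valid for all
exponents, also those below 1. -/

/-! ### Countable sums in L_q, 0 < q ≤ ∞ -/

/-- Countable quasi-triangle inequality in `L_q`, `0 < q ≤ ∞`, at the price of a geometric weight. -/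
theorem exists_eLpNorm_tsum_le {q : ℝ≥0∞} (hq : 0 < q) {D : ℝ≥0} (hD : 1 < D) :
    ∃ C : ℝ≥0, ∀ {α : Type} [MeasurableSpace α] (μ : Measure α) (F : ℕ → α → ℝ≥0∞),
      (∀ k, AEMeasurable (F k) μ) →
        eLpNorm (fun x => ∑' k, F k x) q μ ≤ C * ∑' k, (D : ℝ≥0∞) ^ k * eLpNorm (F k) q μ := by
  -- The weight D is spent in two halves: for finite q, one factor E^k passes from the sum of the
  -- functions to an ℓ^q sum, the other from the ℓ^q sum of the norms back to an ℓ^1 sum. This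
  -- avoids separating q < 1 from q ≥ 1.
  obtain ⟨E, hE, rfl⟩ : ∃ E : ℝ≥0, 1 < E ∧ E ^ 2 = D :=
    ⟨NNReal.sqrt D, by simpa using NNReal.sqrt_lt_sqrt.2 hD, NNReal.sq_sqrt D⟩
  have hE0 : (E : ℝ≥0∞) ≠ 0 := by exact_mod_cast (zero_lt_one.trans hE).ne'
  set d : ℝ≥0∞ := (E : ℝ≥0∞)⁻¹ with hd
  have hd1 : d < 1 := by rw [hd, ENNReal.inv_lt_one]; exact_mod_cast hE
  have hdE : ∀ k : ℕ, d ^ k * (E : ℝ≥0∞) ^ k = 1 := fun k => by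
    rw [← mul_pow, hd, ENNReal.inv_mul_cancel hE0 ENNReal.coe_ne_top, one_pow]
  have hgeom : ∀ x : ℝ≥0∞, x < 1 → ∑' k, x ^ k ≠ ∞ := fun x hx => by
    rw [ENNReal.tsum_geometric]
    exact ENNReal.inv_ne_top.2 (tsub_pos_of_lt hx).ne'
  have key : ∀ (X : ℕ → ℝ≥0∞) (k : ℕ),
      X k ≤ d ^ k * (d ^ k * ∑' k, ((E ^ 2 : ℝ≥0) : ℝ≥0∞) ^ k * X k) := fun X k => by
    calc X k = d ^ k * (d ^ k * (((E ^ 2 : ℝ≥0) : ℝ≥0∞) ^ k * X k)) := by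
          have : d ^ k * (d ^ k * (((E ^ 2 : ℝ≥0) : ℝ≥0∞) ^ k * X k))
              = (d ^ k * (E : ℝ≥0∞) ^ k) * (d ^ k * (E : ℝ≥0∞) ^ k) * X k := by
            push_cast; ring
          rw [this, hdE, one_mul, one_mul]
      _ ≤ _ := by gcongr; exact ENNReal.le_tsum (f := fun k => ((E ^ 2 : ℝ≥0) : ℝ≥0∞) ^ k * X k) k
  by_cases hqt : q = ∞
  · subst hqt
    refine ⟨(∑' k, d ^ k).toNNReal, fun μ F hF => ?_⟩
    rw [ENNReal.coe_toNNReal (hgeom d hd1)]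
    simp only [eLpNorm_exponent_top]
    refine eLpNormEssSup_le_of_ae_enorm_bound ?_
    have : ∀ᵐ x ∂μ, ∀ k, ‖F k x‖ₑ ≤ eLpNormEssSup (F k) μ :=
      ae_all_iff.2 fun k => enorm_ae_le_eLpNormEssSup (F k) μ
    filter_upwards [this] with x hx
    rw [enorm_eq_self, ← ENNReal.tsum_mul_right]
    refine ENNReal.tsum_le_tsum fun k => (hx k).trans ((key (fun k => eLpNormEssSup (F k) μ) k).trans ?_)
    gcongr
    exact mul_le_of_le_one_left' (pow_le_one' hd1.le k)
  · set r := q.toReal with hr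
    have hr0 : 0 < r := ENNReal.toReal_pos hq.ne' hqt
    have hdr : d ^ r < 1 := ENNReal.rpow_lt_one hd1 hr0
    set A : ℝ≥0∞ := ∑' k, d ^ k
    set B : ℝ≥0∞ := (∑' k : ℕ, (d ^ r) ^ k) ^ (1 / r)
    have hB : B ≠ ∞ := ENNReal.rpow_ne_top_of_nonneg (by positivity) (hgeom _ hdr)
    refine ⟨A.toNNReal * B.toNNReal, fun {α} _ μ F hF => ?_⟩
    rw [ENNReal.coe_mul, ENNReal.coe_toNNReal (hgeom d hd1), ENNReal.coe_toNNReal hB]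
    set S : α → ℝ≥0∞ := fun x => (∑' k, ((E : ℝ≥0∞) ^ k * F k x) ^ r) ^ (1 / r) with hS
    have hFS : ∀ x, ∑' k, F k x ≤ A * S x := fun x => by
      rw [← ENNReal.tsum_mul_right]
      refine ENNReal.tsum_le_tsum fun k => ?_
      calc F k x = d ^ k * ((E : ℝ≥0∞) ^ k * F k x) := by rw [← mul_assoc, hdE, one_mul]
        _ = d ^ k * (((E : ℝ≥0∞) ^ k * F k x) ^ r) ^ (1 / r) := by
          rw [← ENNReal.rpow_mul, mul_one_div_cancel hr0.ne', ENNReal.rpow_one]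
        _ ≤ _ := by
          gcongr
          exact ENNReal.rpow_le_rpow
            (ENNReal.le_tsum (f := fun k => ((E : ℝ≥0∞) ^ k * F k x) ^ r) k) (by positivity)
    have h1 : eLpNorm (fun x => ∑' k, F k x) q μ ≤ A * eLpNorm S q μ := by
      have := eLpNorm_le_nnreal_smul_eLpNorm_of_ae_le_mul' (μ := μ) (p := q)
        (f := fun x => ∑' k, F k x) (g := S) (c := A.toNNReal) (ae_of_all _ fun x => by
          rw [ENNReal.coe_toNNReal (hgeom d hd1)]; exact hFS x)
      rwa [ENNReal.smul_def, smul_eq_mul, ENNReal.coe_toNNReal (hgeom d hd1)] at this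
    refine h1.trans ?_
    rw [mul_assoc]
    gcongr
    rw [eLpNorm_eq_lintegral_rpow_enorm_toReal hq.ne' hqt]
    set M := ∑' k, ((E ^ 2 : ℝ≥0) : ℝ≥0∞) ^ k * eLpNorm (F k) q μ with hM
    have hBM : B * M = ((∑' k : ℕ, (d ^ r) ^ k) * M ^ r) ^ (1 / r) := by
      rw [ENNReal.mul_rpow_of_nonneg _ _ (by positivity), ← ENNReal.rpow_mul,
        mul_one_div_cancel hr0.ne', ENNReal.rpow_one]
    rw [hBM]
    refine ENNReal.rpow_le_rpow ?_ (by positivity)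
    have h2 : ∀ x, ‖S x‖ₑ ^ r = ∑' k, ((E : ℝ≥0∞) ^ k * F k x) ^ r := fun x => by
      rw [enorm_eq_self, hS, ← ENNReal.rpow_mul, one_div_mul_cancel hr0.ne', ENNReal.rpow_one]
    rw [← hr]
    simp_rw [h2]
    rw [lintegral_tsum fun k => ((hF k).const_mul _).pow_const _, ← ENNReal.tsum_mul_right]
    refine ENNReal.tsum_le_tsum fun k => ?_
    have h3 : ∫⁻ x, ((E : ℝ≥0∞) ^ k * F k x) ^ r ∂μ
        = ((E : ℝ≥0∞) ^ k * eLpNorm (F k) q μ) ^ r := by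
      rw [eLpNorm_eq_lintegral_rpow_enorm_toReal hq.ne' hqt, ← hr,
        ENNReal.mul_rpow_of_nonneg _ _ hr0.le, ← ENNReal.rpow_mul, one_div_mul_cancel hr0.ne',
        ENNReal.rpow_one]
      simp_rw [ENNReal.mul_rpow_of_nonneg _ _ hr0.le, enorm_eq_self]
      rw [lintegral_const_mul'']
      exact (hF k).pow_const _
    have h4 : (d ^ r) ^ k = (d ^ k) ^ r := by
      rw [← ENNReal.rpow_natCast, ← ENNReal.rpow_natCast, ← ENNReal.rpow_mul, ← ENNReal.rpow_mul,
        mul_comm]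
    rw [h3, h4, ← ENNReal.mul_rpow_of_nonneg _ _ hr0.le]
    refine ENNReal.rpow_le_rpow ?_ hr0.le
    calc _ ≤ (E : ℝ≥0∞) ^ k * (d ^ k * (d ^ k * M)) := by
          gcongr; exact key (fun k => eLpNorm (F k) q μ) k
      _ = (d ^ k * (E : ℝ≥0∞) ^ k) * (d ^ k * M) := by ring
      _ = _ := by rw [hdE, one_mul]

/-! ### Weighted norms: monotonicity, dilations, slowly varying weights -/

theorem weightedNorm_mono {γ : ℝ} {b : ℝ → ℝ} {q : ℝ≥0∞} {I : Set ℝ} (hI : MeasurableSet I)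
    {g h : ℝ → ℝ≥0∞} (hgh : ∀ t ∈ I, g t ≤ h t) :
    weightedNorm γ b q I g ≤ weightedNorm γ b q I h := by
  refine eLpNorm_mono_enorm_ae ?_
  filter_upwards [ae_restrict_mem hI] with t ht
  simp only [enorm_eq_self]
  gcongr
  exact hgh t ht

theorem weightedNorm_mono_set {γ : ℝ} {b : ℝ → ℝ} {q : ℝ≥0∞} {I J : Set ℝ} (hIJ : I ⊆ J)
    (g : ℝ → ℝ≥0∞) : weightedNorm γ b q I g ≤ weightedNorm γ b q J g :=
  eLpNorm_mono_measure _ (Measure.restrict_mono_set _ hIJ)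

theorem weightedNorm_const_mul_le {γ : ℝ} {b : ℝ → ℝ} {q : ℝ≥0∞} {I : Set ℝ} (C : ℝ≥0)
    (g : ℝ → ℝ≥0∞) :
    weightedNorm γ b q I (fun t => C * g t) ≤ C * weightedNorm γ b q I g := by
  have := eLpNorm_le_nnreal_smul_eLpNorm_of_ae_le_mul' (μ := volume.restrict I) (p := q)
    (f := fun t => ENNReal.ofReal (t ^ (γ - (q⁻¹).toReal) * b t) * (C * g t))
    (g := fun t => ENNReal.ofReal (t ^ (γ - (q⁻¹).toReal) * b t) * g t) (c := C)
    (ae_of_all _ fun x => by simp only [enorm_eq_self]; exact (mul_left_comm _ _ _).le)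
  rwa [ENNReal.smul_def, smul_eq_mul] at this

theorem aemeasurable_weight {γ : ℝ} {b : ℝ → ℝ} (hb : SlowlyVarying b) {I : Set ℝ}
    (hI : I ⊆ Ioi 0) :
    AEMeasurable (fun t => ENNReal.ofReal (t ^ γ * b t)) (volume.restrict I) := by
  have := hb.measurable.mono_measure (Measure.restrict_mono_set volume hI)
  exact ((measurable_id.pow_const γ).aemeasurable.mul this).ennreal_ofReal

theorem exists_weightedNorm_tsum_le {q : ℝ≥0∞} (hq : 0 < q) {D : ℝ≥0} (hD : 1 < D) {γ : ℝ}
    {b : ℝ → ℝ} (hb : SlowlyVarying b) :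
    ∃ C : ℝ≥0, ∀ I ⊆ Ioi (0 : ℝ), ∀ F : ℕ → ℝ → ℝ≥0∞,
      (∀ k, AEMeasurable (F k) (volume.restrict I)) →
        weightedNorm γ b q I (fun t => ∑' k, F k t)
          ≤ C * ∑' k, (D : ℝ≥0∞) ^ k * weightedNorm γ b q I (F k) := by
  obtain ⟨C, hC⟩ := exists_eLpNorm_tsum_le hq hD
  refine ⟨C, fun I hI F hF => ?_⟩
  have := hC (volume.restrict I)
    (fun k t => ENNReal.ofReal (t ^ (γ - (q⁻¹).toReal) * b t) * F k t)
    (fun k => (aemeasurable_weight hb hI).mul (hF k))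
  simpa only [weightedNorm, ENNReal.tsum_mul_left] using this

/-- Change of variables: the power weight contributes l^{-(γ-1/q)} and the Jacobian l^{-1/q}, so q
cancels. For γ = 0 only the constant M of the weight b remains. -/
theorem weightedNorm_comp_mul_le {γ : ℝ} {b : ℝ → ℝ} {q : ℝ≥0∞} {l : ℝ}
    (hl : 0 < l) {M : ℝ≥0} (hM : ∀ t, 0 < t → b t ≤ M * b (l * t)) {I : Set ℝ}
    (hI : MeasurableSet I) (hI0 : I ⊆ Ioi 0) (g : ℝ → ℝ≥0∞) :
    weightedNorm γ b q ((l * ·) ⁻¹' I) (fun t => g (l * t))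
      ≤ (((l ^ (-γ)).toNNReal * M : ℝ≥0) : ℝ≥0∞) * weightedNorm γ b q I g := by
  set e := γ - (q⁻¹).toReal with he
  set F : ℝ → ℝ≥0∞ := fun t => ENNReal.ofReal (t ^ e * b t) * g t with hF
  have hpre : MeasurableSet ((l * ·) ⁻¹' I) := (measurable_const_mul l) hI
  have h1 : weightedNorm γ b q ((l * ·) ⁻¹' I) (fun t => g (l * t))
      ≤ (((l ^ (-e)).toNNReal * M : ℝ≥0) : ℝ≥0∞)
        * eLpNorm (F ∘ (l * ·)) q (volume.restrict ((l * ·) ⁻¹' I)) := by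
    have := eLpNorm_le_nnreal_smul_eLpNorm_of_ae_le_mul' (μ := volume.restrict ((l * ·) ⁻¹' I))
      (p := q) (f := fun t => ENNReal.ofReal (t ^ e * b t) * g (l * t)) (g := F ∘ (l * ·))
      (c := (l ^ (-e)).toNNReal * M) ?_
    · rwa [ENNReal.smul_def, smul_eq_mul] at this
    filter_upwards [ae_restrict_mem hpre] with t ht
    have hlt : 0 < l * t := hI0 ht
    have ht0 : 0 < t := pos_of_mul_pos_right hlt hl.le
    simp only [enorm_eq_self, hF, Function.comp_apply]
    rw [← mul_assoc]
    gcongr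
    rw [← ENNReal.ofReal_coe_nnreal, ← ENNReal.ofReal_mul (by positivity)]
    refine ENNReal.ofReal_le_ofReal ?_
    rw [NNReal.coe_mul, Real.coe_toNNReal _ (by positivity)]
    calc t ^ e * b t ≤ t ^ e * (M * b (l * t)) := by gcongr; exact hM t ht0
      _ = (l ^ (-e) * l ^ e) * t ^ e * (M * b (l * t)) := by
        rw [← Real.rpow_add hl, neg_add_cancel, Real.rpow_zero, one_mul]
      _ = l ^ (-e) * M * ((l * t) ^ e * b (l * t)) := by
        rw [Real.mul_rpow hl.le ht0.le]; ring
  have hemb : MeasurableEmbedding (l * · : ℝ → ℝ) := measurableEmbedding_mulLeft₀ hl.ne'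
  have h2 : eLpNorm (F ∘ (l * ·)) q (volume.restrict ((l * ·) ⁻¹' I))
      = ENNReal.ofReal (l ^ (-(q⁻¹).toReal)) * weightedNorm γ b q I g := by
    rw [← hemb.eLpNorm_map_measure, ← Measure.restrict_map hemb.measurable hI,
      Real.map_volume_mul_left hl.ne', Measure.restrict_smul,
      eLpNorm_smul_measure_of_ne_zero (by simpa using hl.ne'), smul_eq_mul, abs_of_pos (by positivity)]
    congr 1
    rw [ENNReal.ofReal_rpow_of_pos (by positivity), Real.inv_rpow hl.le, Real.rpow_neg hl.le]
    simp
  rw [h2, ← mul_assoc] at h1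
  convert h1 using 2
  have : ENNReal.ofReal (l ^ (-(q⁻¹).toReal)) = (((l ^ (-(q⁻¹).toReal)).toNNReal : ℝ≥0) : ℝ≥0∞) :=
    rfl
  rw [this, ← ENNReal.coe_mul, ENNReal.coe_inj]
  rw [mul_right_comm, ← Real.toNNReal_mul (by positivity), ← Real.rpow_add hl]
  congr 3
  rw [he]; ring

theorem weightedNorm_eq_top {γ : ℝ} {b : ℝ → ℝ} {q : ℝ≥0∞} (hq : 0 < q)
    (hb : ∀ t, 0 < t → 0 < b t) {I : Set ℝ} (hI : MeasurableSet I) (hI0 : I ⊆ Ioi 0)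
    (hIv : volume I ≠ 0) {g : ℝ → ℝ≥0∞} (hg : ∀ t ∈ I, g t = ∞) :
    weightedNorm γ b q I g = ∞ := by
  have h0 : volume.restrict I ≠ 0 := by simpa using hIv
  rw [eq_top_iff]
  calc ∞ = eLpNorm (fun _ : ℝ => (∞ : ℝ≥0∞)) q (volume.restrict I) := by
        rw [eLpNorm_const _ hq.ne' h0, enorm_eq_self, ENNReal.top_mul]
        rw [ne_eq, ENNReal.rpow_eq_zero_iff]
        simp only [Measure.restrict_apply_univ, hIv, false_and, false_or, not_and, not_lt]
        intro _; positivity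
    _ ≤ _ := by
        refine eLpNorm_mono_enorm_ae ?_
        filter_upwards [ae_restrict_mem hI] with t ht
        have ht0 : 0 < t := hI0 ht
        rw [hg t ht, enorm_eq_self, ENNReal.mul_top, enorm_eq_self]
        simpa using mul_pos (Real.rpow_pos_of_pos ht0 _) (hb t ht0)

/-- Since t^{-ε} b(t) is decreasing up to a constant, its value at t is controlled by that at lt ≤
t. The constant is uniform in l, which the summation over dyadic dilations requires. -/
theorem SlowlyVarying.exists_le_mul {b : ℝ → ℝ} (hb : SlowlyVarying b) {ε : ℝ} (hε : 0 < ε) :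
    ∃ C : ℝ≥0, ∀ l, 0 < l → l ≤ 1 → ∀ t, 0 < t → b t ≤ C * l ^ (-ε) * b (l * t) := by
  obtain ⟨g, hg, C, hC, h⟩ := hb.equiv_decreasing ε hε
  refine ⟨⟨C * C, by positivity⟩, fun l hl hl1 t ht => ?_⟩
  have hlt : 0 < l * t := mul_pos hl ht
  have h1 : t ^ (-ε) * b t ≤ C * (C * ((l * t) ^ (-ε) * b (l * t))) :=
    (h t ht).2.trans (mul_le_mul_of_nonneg_left
      ((hg hlt ht (mul_le_of_le_one_left ht.le hl1)).trans (h _ hlt).1) hC.le)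
  rw [Real.mul_rpow hl.le ht.le] at h1
  refine le_of_mul_le_mul_left (h1.trans_eq ?_) (Real.rpow_pos_of_pos ht (-ε))
  change _ = t ^ (-ε) * (C * C * l ^ (-ε) * b (l * t))
  ring

/-! ### Nested norms over dilation families and Hardy's inequality -/

/-- A dilation-invariant monotone family of subintervals of `(0,∞)`. -/
structure IsDilationFamily (J : ℝ → Set ℝ) : Prop where
  measurableSet : ∀ t, MeasurableSet (J t)
  subset : ∀ t, 0 < t → J t ⊆ Ioi 0
  preimage : ∀ l, 0 < l → ∀ t, (l * ·) ⁻¹' J (l * t) = J t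
  volume_ne : ∀ t, 0 < t → volume (J t) ≠ 0
  mono : Monotone J ∨ Antitone J

theorem isDilationFamily_Ioo : IsDilationFamily (Ioo 0) where
  measurableSet _ := measurableSet_Ioo
  subset _ _ := Ioo_subset_Ioi_self
  preimage l hl t := by
    ext x
    simp only [mem_preimage, mem_Ioo, mul_pos_iff_of_pos_left hl, mul_lt_mul_iff_right₀ hl]
  volume_ne t ht := by simpa using ht
  mono := Or.inl fun _ _ h => Ioo_subset_Ioo_right h

theorem isDilationFamily_Ioi : IsDilationFamily Ioi where
  measurableSet _ := measurableSet_Ioi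
  subset _ ht := Ioi_subset_Ioi ht.le
  preimage l hl t := by
    ext x
    simp only [mem_preimage, mem_Ioi, mul_lt_mul_iff_right₀ hl]
  volume_ne t _ := by simp
  mono := Or.inr fun _ _ h => Ioi_subset_Ioi h

/-- The common form of `normLL` (`J u = (0,u)`) and `normRR` (`J u = (u,∞)`). -/
noncomputable def nestedNorm (J : ℝ → Set ℝ) (γ : ℝ) (s : ℝ≥0∞) (c : ℝ → ℝ) (r : ℝ≥0∞) (b : ℝ → ℝ)
    (q : ℝ≥0∞) (a : ℝ → ℝ) (g : ℝ → ℝ≥0∞) : ℝ≥0∞ :=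
  weightedNorm 0 c s (Ioi 0) fun t => weightedNorm 0 b r (J t) fun u => weightedNorm γ a q (J u) g

theorem weightedNorm_congr {γ : ℝ} {b : ℝ → ℝ} {q : ℝ≥0∞} {I : Set ℝ} (hI : MeasurableSet I)
    {g h : ℝ → ℝ≥0∞} (hgh : ∀ t ∈ I, g t = h t) :
    weightedNorm γ b q I g = weightedNorm γ b q I h :=
  le_antisymm (weightedNorm_mono hI fun t ht => (hgh t ht).le)
    (weightedNorm_mono hI fun t ht => (hgh t ht).ge)

theorem weightedNorm_ofReal_mul {γ : ℝ} {b : ℝ → ℝ} {q : ℝ≥0∞} {I : Set ℝ} (hI : MeasurableSet I)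
    (hI0 : I ⊆ Ioi 0) (g : ℝ → ℝ≥0∞) :
    weightedNorm γ b q I (fun t => ENNReal.ofReal t * g t) = weightedNorm (γ + 1) b q I g := by
  refine eLpNorm_congr_ae ?_
  filter_upwards [ae_restrict_mem hI] with t ht
  have ht0 : 0 < t := hI0 ht
  rw [← mul_assoc, ← ENNReal.ofReal_mul' ht0.le,
    show γ + 1 - (q⁻¹).toReal = γ - (q⁻¹).toReal + 1 by ring, Real.rpow_add_one ht0.ne']
  congr 2
  ring

section

variable {J : ℝ → Set ℝ} {γ : ℝ} {q r s : ℝ≥0∞} {a b c : ℝ → ℝ}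

/-- The norm is monotone in the interval, hence monotone in u, so no measurability of g or of the
weight is needed. -/
theorem IsDilationFamily.measurable_weightedNorm (hJ : IsDilationFamily J) (g : ℝ → ℝ≥0∞) :
    Measurable fun u => weightedNorm γ a q (J u) g := by
  rcases hJ.mono with h | h
  · exact Monotone.measurable fun u v huv => weightedNorm_mono_set (h huv) g
  · exact Antitone.measurable fun u v huv => weightedNorm_mono_set (h huv) g

theorem IsDilationFamily.nestedNorm_mono (hJ : IsDilationFamily J) {g h : ℝ → ℝ≥0∞}
    (hgh : ∀ t, 0 < t → g t ≤ h t) :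
    nestedNorm J γ s c r b q a g ≤ nestedNorm J γ s c r b q a h :=
  weightedNorm_mono measurableSet_Ioi fun t ht => weightedNorm_mono (hJ.measurableSet t)
    fun u hu => weightedNorm_mono (hJ.measurableSet u)
      fun v hv => hgh v (hJ.subset u (hJ.subset t ht hu) hv)

theorem IsDilationFamily.nestedNorm_const_mul_le (hJ : IsDilationFamily J) (C : ℝ≥0)
    (g : ℝ → ℝ≥0∞) :
    nestedNorm J γ s c r b q a (fun t => C * g t) ≤ C * nestedNorm J γ s c r b q a g :=
  (weightedNorm_mono measurableSet_Ioi fun t _ => (weightedNorm_mono (hJ.measurableSet t)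
    fun _ _ => weightedNorm_const_mul_le C g).trans (weightedNorm_const_mul_le C _)).trans
      (weightedNorm_const_mul_le C _)

theorem IsDilationFamily.nestedNorm_ofReal_mul (hJ : IsDilationFamily J) (g : ℝ → ℝ≥0∞) :
    nestedNorm J γ s c r b q a (fun t => ENNReal.ofReal t * g t)
      = nestedNorm J (γ + 1) s c r b q a g :=
  weightedNorm_congr measurableSet_Ioi fun t ht => weightedNorm_congr (hJ.measurableSet t)
    fun u hu => weightedNorm_ofReal_mul (hJ.measurableSet u) (hJ.subset u (hJ.subset t ht hu)) g

/-- Applied to f**, this supplies one t with f**(t) finite, which suffices to put f in L_1 + L_∞. -/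
theorem IsDilationFamily.exists_ne_top (hJ : IsDilationFamily J) (hq : 0 < q) (hr : 0 < r)
    (hs : 0 < s) (ha : SlowlyVarying a) (hb : SlowlyVarying b) (hc : SlowlyVarying c)
    {g : ℝ → ℝ≥0∞} (hg : nestedNorm J γ s c r b q a g < ∞) : ∃ t, 0 < t ∧ g t ≠ ∞ := by
  by_contra! h
  refine hg.ne (weightedNorm_eq_top hs hc.pos measurableSet_Ioi subset_rfl (by simp) fun t ht => ?_)
  refine weightedNorm_eq_top hr hb.pos (hJ.measurableSet t) (hJ.subset t ht) (hJ.volume_ne t ht)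
    fun u hu => ?_
  have hu0 : 0 < u := hJ.subset t ht hu
  exact weightedNorm_eq_top hq ha.pos (hJ.measurableSet u) (hJ.subset u hu0) (hJ.volume_ne u hu0)
    fun v hv => h v (hJ.subset u hu0 hv)

/-- One change of variables per layer; only the innermost carries a power of l, the outer two having
exponent 0. -/
theorem IsDilationFamily.nestedNorm_comp_mul_le (hJ : IsDilationFamily J) {l : ℝ} (hl : 0 < l)
    {A B C : ℝ≥0} (hA : ∀ t, 0 < t → a t ≤ A * a (l * t)) (hB : ∀ t, 0 < t → b t ≤ B * b (l * t))
    (hC : ∀ t, 0 < t → c t ≤ C * c (l * t)) (g : ℝ → ℝ≥0∞) :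
    nestedNorm J γ s c r b q a (fun t => g (l * t))
      ≤ (((l ^ (-γ)).toNNReal * A * B * C : ℝ≥0) : ℝ≥0∞) * nestedNorm J γ s c r b q a g := by
  have h1 : ∀ u, 0 < u → weightedNorm γ a q (J u) (fun t => g (l * t))
      ≤ (((l ^ (-γ)).toNNReal * A : ℝ≥0) : ℝ≥0∞) * weightedNorm γ a q (J (l * u)) g := fun u hu => by
    rw [← hJ.preimage l hl u]
    exact weightedNorm_comp_mul_le hl hA (hJ.measurableSet _) (hJ.subset _ (mul_pos hl hu)) g
  have h2 : ∀ t, 0 < t →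
      weightedNorm 0 b r (J t) (fun u => weightedNorm γ a q (J u) (fun t => g (l * t)))
      ≤ (((l ^ (-γ)).toNNReal * A * B : ℝ≥0) : ℝ≥0∞)
        * weightedNorm 0 b r (J (l * t)) (fun u => weightedNorm γ a q (J u) g) := fun t ht => by
    refine (weightedNorm_mono (hJ.measurableSet t) fun u hu => h1 u (hJ.subset t ht hu)).trans ?_
    refine (weightedNorm_const_mul_le _ _).trans ?_
    rw [ENNReal.coe_mul _ B, mul_assoc _ (B : ℝ≥0∞)]
    gcongr
    rw [← hJ.preimage l hl t]
    have := weightedNorm_comp_mul_le (γ := 0) (q := r) hl hB (hJ.measurableSet (l * t))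
      (hJ.subset _ (mul_pos hl ht)) (fun u => weightedNorm γ a q (J u) g)
    simpa using this
  refine (weightedNorm_mono measurableSet_Ioi fun t ht => h2 t ht).trans ?_
  refine (weightedNorm_const_mul_le _ _).trans ?_
  rw [ENNReal.coe_mul _ C, mul_assoc _ (C : ℝ≥0∞)]
  gcongr
  have hp : (l * ·) ⁻¹' Ioi (0 : ℝ) = Ioi 0 := by ext x; simp [hl]
  have := weightedNorm_comp_mul_le (γ := 0) (q := s) hl hC measurableSet_Ioi subset_rfl
    (fun t => weightedNorm 0 b r (J t) (fun u => weightedNorm γ a q (J u) g))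
  rw [hp] at this
  simpa [nestedNorm] using this

/-- Each of the three layers costs a factor D^k, whence the exponent 3k. -/
theorem IsDilationFamily.exists_nestedNorm_tsum_le (hJ : IsDilationFamily J) (hq : 0 < q)
    (hr : 0 < r) (hs : 0 < s) (ha : SlowlyVarying a) (hb : SlowlyVarying b) (hc : SlowlyVarying c)
    {D : ℝ≥0} (hD : 1 < D) :
    ∃ C : ℝ≥0, ∀ F : ℕ → ℝ → ℝ≥0∞, (∀ k, Measurable (F k)) →
      nestedNorm J γ s c r b q a (fun t => ∑' k, F k t)
        ≤ C * ∑' k, ((D ^ (3 * k) : ℝ≥0) : ℝ≥0∞) * nestedNorm J γ s c r b q a (F k) := by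
  obtain ⟨C₁, h₁⟩ := exists_weightedNorm_tsum_le hq hD (γ := γ) ha
  obtain ⟨C₂, h₂⟩ := exists_weightedNorm_tsum_le hr hD (γ := 0) hb
  obtain ⟨C₃, h₃⟩ := exists_weightedNorm_tsum_le hs hD (γ := 0) hc
  refine ⟨C₁ * C₂ * C₃, fun F hF => ?_⟩
  have e₂ : ∀ t, 0 < t →
      weightedNorm 0 b r (J t) (fun u => weightedNorm γ a q (J u) (fun t => ∑' k, F k t))
      ≤ ((C₁ * C₂ : ℝ≥0) : ℝ≥0∞) * ∑' k, ((D ^ (2 * k) : ℝ≥0) : ℝ≥0∞) *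
        weightedNorm 0 b r (J t) (fun u => weightedNorm γ a q (J u) (F k)) := fun t ht => by
    refine (weightedNorm_mono (hJ.measurableSet t) fun u hu =>
      h₁ (J u) (hJ.subset u (hJ.subset t ht hu)) F fun k => (hF k).aemeasurable).trans ?_
    refine (weightedNorm_const_mul_le _ _).trans ?_
    rw [ENNReal.coe_mul, mul_assoc]
    gcongr
    refine (h₂ (J t) (hJ.subset t ht) _ fun k =>
      ((hJ.measurable_weightedNorm (F k)).const_mul _).aemeasurable).trans ?_
    refine mul_le_mul_right (ENNReal.tsum_le_tsum fun k => ?_) _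
    rw [two_mul, pow_add, ENNReal.coe_mul, mul_assoc, ← ENNReal.coe_pow]
    gcongr
    exact weightedNorm_const_mul_le (D ^ k) _
  refine (weightedNorm_mono measurableSet_Ioi fun t ht => e₂ t ht).trans ?_
  refine (weightedNorm_const_mul_le _ _).trans ?_
  rw [ENNReal.coe_mul _ C₃, mul_assoc _ (C₃ : ℝ≥0∞)]
  gcongr
  refine (h₃ (Ioi 0) subset_rfl _ fun k =>
      ((hJ.measurable_weightedNorm _).const_mul _).aemeasurable).trans ?_
  refine mul_le_mul_right (ENNReal.tsum_le_tsum fun k => ?_) _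
  rw [show 3 * k = k + 2 * k by ring, pow_add, ENNReal.coe_mul, mul_assoc, ← ENNReal.coe_pow]
  gcongr
  exact weightedNorm_const_mul_le (D ^ (2 * k)) _

/-- Hardy's inequality for the nested norms, in dyadic form. -/
theorem IsDilationFamily.exists_nestedNorm_dyadic_le (hJ : IsDilationFamily J) (hq : 0 < q)
    (hr : 0 < r) (hs : 0 < s) (ha : SlowlyVarying a) (hb : SlowlyVarying b) (hc : SlowlyVarying c)
    (hγ : γ < 1) :
    ∃ C : ℝ≥0, ∀ g : ℝ → ℝ≥0∞, Measurable g →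
      nestedNorm J γ s c r b q a
          (fun t => ∑' k : ℕ, ENNReal.ofReal ((1 / 2) ^ (k + 1)) * g ((1 / 2) ^ (k + 1) * t))
        ≤ C * nestedNorm J γ s c r b q a g := by
  -- With y = 2^{-ε}, the gain l · l^{-γ} is y^{8(k+1)}. The three weights cost y^{-3(k+1)} and the
  -- quasi-triangle inequality with D = y⁻¹ costs y^{-3k}. What remains is y^{2k+5} ≤ y^k, which is
  -- summable.
  set ε : ℝ := (1 - γ) / 8 with hε
  have hε0 : 0 < ε := by rw [hε]; linarith
  obtain ⟨A, hA⟩ := ha.exists_le_mul hε0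
  obtain ⟨B, hB⟩ := hb.exists_le_mul hε0
  obtain ⟨C, hC⟩ := hc.exists_le_mul hε0
  set y : ℝ≥0 := (1 / 2 : ℝ≥0) ^ ε with hy
  have hy0 : 0 < y := NNReal.rpow_pos (by positivity)
  have hy1 : y < 1 := NNReal.rpow_lt_one (NNReal.half_lt_self one_ne_zero) hε0
  have hD : 1 < y⁻¹ := (one_lt_inv₀ hy0).2 hy1
  obtain ⟨K, hK⟩ := hJ.exists_nestedNorm_tsum_le hq hr hs ha hb hc (γ := γ) hD
  have hgeom : ∑' k : ℕ, (y : ℝ≥0∞) ^ k ≠ ∞ := by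
    rw [ENNReal.tsum_geometric]
    exact ENNReal.inv_ne_top.2 (tsub_pos_of_lt (by exact_mod_cast hy1)).ne'
  refine ⟨K * (A * B * C * (∑' k : ℕ, (y : ℝ≥0∞) ^ k).toNNReal), fun g hg => ?_⟩
  refine (hK _ fun k => (hg.comp (measurable_const_mul _)).const_mul _).trans ?_
  rw [ENNReal.coe_mul, mul_assoc]
  gcongr
  rw [ENNReal.coe_mul, ENNReal.coe_toNNReal hgeom, mul_assoc, ← ENNReal.tsum_mul_right,
    ← ENNReal.tsum_mul_left]
  refine ENNReal.tsum_le_tsum fun k => ?_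
  set l : ℝ := (1 / 2) ^ (k + 1) with hl
  have hl0 : 0 < l := by positivity
  have hl1 : l ≤ 1 := pow_le_one₀ (by norm_num) (by norm_num)
  have hle : ∀ e : ℝ, l ^ e = ((1 / 2 : ℝ) ^ e) ^ (k + 1) := fun e => by
    rw [hl, ← Real.rpow_natCast, ← Real.rpow_natCast, ← Real.rpow_mul (by norm_num),
      ← Real.rpow_mul (by norm_num), mul_comm]
  set m : ℝ≥0 := (l ^ (-ε)).toNNReal with hm
  have hmc : (m : ℝ) = l ^ (-ε) := Real.coe_toNNReal _ (by positivity)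
  have hscale := hJ.nestedNorm_comp_mul_le (γ := γ) (q := q) (r := r) (s := s) hl0
    (A := A * m) (B := B * m) (C := C * m)
    (fun t ht => by rw [NNReal.coe_mul, hmc]; exact hA l hl0 hl1 t ht)
    (fun t ht => by rw [NNReal.coe_mul, hmc]; exact hB l hl0 hl1 t ht)
    (fun t ht => by rw [NNReal.coe_mul, hmc]; exact hC l hl0 hl1 t ht) g
  have hconst := hJ.nestedNorm_const_mul_le (γ := γ) (q := q) (r := r) (s := s) (a := a) (b := b)
    (c := c) l.toNNReal (fun t => g (l * t))
  have hnum : y⁻¹ ^ (3 * k) * l.toNNReal *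
      ((l ^ (-γ)).toNNReal * (A * m) * (B * m) * (C * m)) ≤ A * B * C * y ^ k := by
    have hym : m = y⁻¹ ^ (k + 1) := by
      rw [← NNReal.coe_inj, hmc, hle, Real.rpow_neg (by norm_num)]
      simp [hy]
    have hl8 : l.toNNReal * (l ^ (-γ)).toNNReal = y ^ (8 * (k + 1)) := by
      rw [← Real.toNNReal_mul hl0.le, ← NNReal.coe_inj, Real.coe_toNNReal _ (by positivity)]
      nth_rewrite 1 [← Real.rpow_one l]
      rw [← Real.rpow_add hl0, show 1 + -γ = ε * 8 by rw [hε]; ring, hle,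
        Real.rpow_mul (by norm_num), pow_mul]
      simp [hy]
    calc _ = A * B * C * (y⁻¹ ^ (3 * k) * (l.toNNReal * (l ^ (-γ)).toNNReal) * m ^ 3) := by ring
      _ = A * B * C * (y⁻¹ ^ (3 * k) * y ^ (8 * (k + 1)) * (y⁻¹ ^ (k + 1)) ^ 3) := by
        rw [hl8, hym]
      _ = A * B * C * ((y⁻¹ * y) ^ (6 * k + 3) * y ^ (2 * k + 5)) := by ring
      _ ≤ _ := by
        rw [inv_mul_cancel₀ hy0.ne', one_pow, one_mul]
        exact mul_le_mul_right (pow_le_pow_of_le_one hy0.le hy1.le (by lia)) _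
  calc _ ≤ ((y⁻¹ ^ (3 * k) : ℝ≥0) : ℝ≥0∞) * (l.toNNReal *
        ((((l ^ (-γ)).toNNReal * (A * m) * (B * m) * (C * m) : ℝ≥0) : ℝ≥0∞)
          * nestedNorm J γ s c r b q a g)) := by
        gcongr
        exact hconst.trans (by gcongr)
    _ = ((y⁻¹ ^ (3 * k) * l.toNNReal *
      ((l ^ (-γ)).toNNReal * (A * m) * (B * m) * (C * m)) : ℝ≥0) : ℝ≥0∞)
        * nestedNorm J γ s c r b q a g := by
        simp only [ENNReal.coe_mul]; ring
    _ ≤ ((A * B * C * y ^ k : ℝ≥0) : ℝ≥0∞) * nestedNorm J γ s c r b q a g := by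
        gcongr
    _ = _ := by rw [ENNReal.coe_mul _ (y ^ k), ENNReal.coe_pow, mul_assoc]

end

/-! ### Rearrangements, truncation and the K-functional -/

section

variable {Ω : Type*} [MeasurableSpace Ω] {μ : Measure Ω} {𝕜 : Type*} [RCLike 𝕜]

theorem rearrangement_antitone (f : Ω →ₘ[μ] 𝕜) : Antitone (rearrangement f) := fun _ _ h =>
  sInf_le_sInf fun _ hl => le_trans hl (ENNReal.ofReal_le_ofReal h)

/-- The infimum defining f*(t) is attained: levels decreasing to it give increasing superlevel sets,
and the measure is continuous from below. -/
theorem measure_rearrangement_lt_le (f : Ω →ₘ[μ] 𝕜) (t : ℝ) :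
    μ {x | rearrangement f t < ‖f x‖ₑ} ≤ ENNReal.ofReal t := by
  set S : Set ℝ≥0∞ := {l : ℝ≥0∞ | μ {x | l < ‖f x‖ₑ} ≤ ENNReal.ofReal t} with hS
  obtain ⟨u, hu, hlim, huS⟩ := exists_seq_tendsto_sInf (S := S) ⟨∞, by simp [hS]⟩ (OrderBot.bddBelow S)
  have hunion : {x | rearrangement f t < ‖f x‖ₑ} ⊆ ⋃ n, {x | u n < ‖f x‖ₑ} := fun x hx => by
    obtain ⟨n, hn⟩ := (hlim.eventually (gt_mem_nhds (show sInf S < ‖f x‖ₑ from hx))).exists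
    exact mem_iUnion.2 ⟨n, hn⟩
  refine (measure_mono hunion).trans ?_
  have hmono : Monotone fun n => {x | u n < ‖f x‖ₑ} := fun i j hij x hx =>
    lt_of_le_of_lt (hu hij) hx
  rw [hmono.measure_iUnion]
  exact iSup_le huS

theorem le_rearrangement {f : Ω →ₘ[μ] 𝕜} {t : ℝ} {l : ℝ≥0∞}
    (h : ENNReal.ofReal t < μ {x | l < ‖f x‖ₑ}) : l ≤ rearrangement f t :=
  le_sInf fun l' hl' => by
    by_contra! hlt
    exact (h.trans_le ((measure_mono fun x hx => hlt.trans hx).trans hl')).false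

theorem ofReal_mul_rearrangement_le (f : Ω →ₘ[μ] 𝕜) {t : ℝ} (ht : 0 < t) :
    ENNReal.ofReal t * rearrangement f t ≤ eLpNorm f 1 μ := by
  have ht' : ENNReal.ofReal t ≠ 0 := by simpa using ht
  rw [mul_comm, ← ENNReal.le_div_iff_mul_le (Or.inl ht') (Or.inl ENNReal.ofReal_ne_top)]
  refine sInf_le ?_
  rcases eq_or_ne (eLpNorm f 1 μ) 0 with h0 | h0
  · rw [eLpNorm_eq_zero_iff f.aestronglyMeasurable one_ne_zero] at h0
    have : μ {x | eLpNorm f 1 μ / ENNReal.ofReal t < ‖f x‖ₑ} = 0 := by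
      refine measure_mono_null (fun x hx => ?_) (ae_iff.1 h0)
      intro hfx
      simp only [Pi.zero_apply] at hfx
      simp [hfx] at hx
    simp [this]
  rcases eq_or_ne (eLpNorm f 1 μ) ∞ with h1 | h1
  · simp [h1, ENNReal.top_div_of_ne_top ENNReal.ofReal_ne_top]
  have hl0 : eLpNorm f 1 μ / ENNReal.ofReal t ≠ 0 := (ENNReal.div_pos h0 ENNReal.ofReal_ne_top).ne'
  have hlt : eLpNorm f 1 μ / ENNReal.ofReal t ≠ ∞ := ENNReal.div_ne_top h1 ht'
  have hm : AEMeasurable (fun x => ‖f x‖ₑ) μ := f.aestronglyMeasurable.enorm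
  have hM := meas_ge_le_lintegral_div hm hl0 hlt
  rw [← eLpNorm_one_eq_lintegral_enorm] at hM
  have hsub : {x | eLpNorm f 1 μ / ENNReal.ofReal t < ‖f x‖ₑ}
      ⊆ {x | eLpNorm f 1 μ / ENNReal.ofReal t ≤ ‖f x‖ₑ} := by
    intro x hx
    rw [mem_ofPred_eq] at hx ⊢
    exact hx.le
  refine ((measure_mono hsub).trans hM).trans_eq ?_
  rw [ENNReal.div_div_cancel h0 h1]

/-- Almost everywhere, |f+g| can exceed f*(t) + ‖g‖_∞ only where |f| exceeds f*(t), a set of measure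
at most t. -/
theorem rearrangement_add_le (f g : Ω →ₘ[μ] 𝕜) (t : ℝ) :
    rearrangement (f + g) t ≤ rearrangement f t + eLpNorm g ∞ μ := by
  refine sInf_le ((measure_mono_ae ?_).trans (measure_rearrangement_lt_le f t))
  filter_upwards [AEEqFun.coeFn_add f g, enorm_ae_le_eLpNormEssSup g μ] with x hx hgx hlt
  rw [eLpNorm_exponent_top] at hlt
  change _ < ‖(f + g) x‖ₑ at hlt
  change _ < ‖f x‖ₑ
  rw [hx, Pi.add_apply] at hlt
  by_contra! h
  exact ((enorm_add_le _ _).trans (add_le_add h hgx)).not_gt hlt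

theorem ofReal_mul_rearrangement_le_peetreK (f : Ω →ₘ[μ] 𝕜) {t : ℝ} (ht : 0 < t) :
    ENNReal.ofReal t * rearrangement f t
      ≤ peetreK (weakL1 μ 𝕜) (lebesgueSpace μ 𝕜 ∞) f t := by
  refine le_iInf fun f₀ => le_iInf fun _ => le_iInf fun f₁ => le_iInf fun _ => le_iInf fun h => ?_
  rw [h]
  refine (mul_le_mul_right (rearrangement_add_le f₀ f₁ t) _).trans ?_
  rw [mul_add]
  refine add_le_add ?_ le_rfl
  exact le_iSup₂ (f := fun (t : ℝ) (_ : 0 < t) => ENNReal.ofReal t * rearrangement f₀ t) t ht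

theorem weakL1_qnorm_le (f : Ω →ₘ[μ] 𝕜) :
    (weakL1 μ 𝕜).qnorm f ≤ (lebesgueSpace μ 𝕜 1).qnorm f :=
  iSup₂_le fun _ ht => ofReal_mul_rearrangement_le f ht

theorem lebesgueSpace_one_subset_weakL1 :
    (lebesgueSpace μ 𝕜 1).elements ⊆ (weakL1 μ 𝕜).elements :=
  fun f hf => (weakL1_qnorm_le f).trans_lt hf

theorem peetreK_weakL1_le (A : Space (Ω →ₘ[μ] 𝕜)) (f : Ω →ₘ[μ] 𝕜) (t : ℝ) :
    peetreK (weakL1 μ 𝕜) A f t ≤ peetreK (lebesgueSpace μ 𝕜 1) A f t :=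
  iInf_mono fun f₀ => le_iInf fun h₀ => (iInf_le _ (lebesgueSpace_one_subset_weakL1 h₀)).trans <|
    iInf_mono fun _ => iInf_mono fun _ => iInf_mono fun _ =>
      add_le_add (weakL1_qnorm_le f₀) le_rfl

/-- By the layer-cake formula the left side is the area of the region u < d(l), with d the
distribution function of |f| on E. Swapping the order of integration, d(l) > u forces l ≤ f*(u), so
the section at u has length at most f*(u). -/
theorem setLIntegral_enorm_le (f : Ω →ₘ[μ] 𝕜) {E : Set Ω} {t : ℝ}
    (hEt : μ E ≤ ENNReal.ofReal t) :
    ∫⁻ x in E, ‖f x‖ₑ ∂μ ≤ ∫⁻ u in Ioo 0 t, rearrangement f u := by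
  have hd : Antitone fun l : ℝ => (μ.restrict E) {x | l < ‖f x‖} := fun l l' h =>
    measure_mono fun x hx => lt_of_le_of_lt h hx
  set d : ℝ → ℝ≥0∞ := fun l => (μ.restrict E) {x | l < ‖f x‖} with hdd
  have hdm : Measurable d := hd.measurable
  have hdt : ∀ l, d l ≤ ENNReal.ofReal t := fun l => (measure_mono (subset_univ _)).trans (by
    rwa [Measure.restrict_apply_univ])
  set T : Set (ℝ × ℝ) := {p | ENNReal.ofReal p.2 < d p.1} with hT
  have hTm : MeasurableSet T := measurableSet_lt
    (ENNReal.measurable_ofReal.comp measurable_snd) (hdm.comp measurable_fst)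
  calc ∫⁻ x in E, ‖f x‖ₑ ∂μ = ∫⁻ x in E, ENNReal.ofReal ‖f x‖ ∂μ := by simp_rw [ofReal_norm]
    _ = ∫⁻ l in Ioi 0, d l := lintegral_eq_lintegral_meas_lt _
        (ae_of_all _ fun _ => norm_nonneg _) f.aestronglyMeasurable.restrict.norm.aemeasurable
    _ = ∫⁻ l in Ioi 0, ∫⁻ u in Ioo 0 t, T.indicator 1 (l, u) := by
        refine setLIntegral_congr_fun measurableSet_Ioi fun l _ => ?_
        have hdl : d l ≠ ∞ := ((hdt l).trans_lt ENNReal.ofReal_lt_top).ne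
        have hsec : MeasurableSet {u : ℝ | (l, u) ∈ T} := measurable_prodMk_left hTm
        have : ∀ u, T.indicator (1 : ℝ × ℝ → ℝ≥0∞) (l, u)
            = {u : ℝ | (l, u) ∈ T}.indicator 1 u := fun u => rfl
        simp_rw [this]
        rw [lintegral_indicator_one hsec, Measure.restrict_apply hsec]
        -- The bound d(l) ≤ μ(E) ≤ t ensures that restricting u to (0,t) loses no area.
        have hset : {u : ℝ | (l, u) ∈ T} ∩ Ioo 0 t = Ioo 0 (d l).toReal := by
          ext u
          simp only [hT, mem_inter_iff, mem_ofPred_eq, mem_Ioo]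
          constructor
          · rintro ⟨h, h0, -⟩
            exact ⟨h0, (ENNReal.ofReal_lt_iff_lt_toReal h0.le hdl).1 h⟩
          · rintro ⟨h0, h⟩
            have h' := (ENNReal.ofReal_lt_iff_lt_toReal h0.le hdl).2 h
            exact ⟨h', h0, (ENNReal.ofReal_lt_ofReal_iff_of_nonneg h0.le).1 (h'.trans_le (hdt l))⟩
        rw [hset, Real.volume_Ioo, sub_zero, ENNReal.ofReal_toReal hdl]
    _ = ∫⁻ u in Ioo 0 t, ∫⁻ l in Ioi 0, T.indicator 1 (l, u) :=
        lintegral_lintegral_swap (measurable_one.indicator hTm).aemeasurable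
    _ ≤ ∫⁻ u in Ioo 0 t, rearrangement f u := by
        refine lintegral_mono fun u => ?_
        have hsec : MeasurableSet {l : ℝ | (l, u) ∈ T} := measurable_prodMk_right hTm
        have : ∀ l, T.indicator (1 : ℝ × ℝ → ℝ≥0∞) (l, u)
            = {l : ℝ | (l, u) ∈ T}.indicator 1 l := fun u => rfl
        simp_rw [this]
        rw [lintegral_indicator_one hsec, Measure.restrict_apply hsec]
        rcases eq_or_ne (rearrangement f u) ∞ with h | h
        · simp [h]
        have hsub : {l : ℝ | (l, u) ∈ T} ∩ Ioi 0 ⊆ Icc 0 (rearrangement f u).toReal := by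
          rintro l ⟨hl, hl0⟩
          refine ⟨le_of_lt hl0, (ENNReal.ofReal_le_iff_le_toReal h).1 (le_rearrangement ?_)⟩
          refine lt_of_lt_of_le hl ((Measure.restrict_apply_le _ _).trans (measure_mono ?_))
          intro x hx
          change ENNReal.ofReal l < ‖f x‖ₑ
          rw [← ofReal_norm]
          exact (ENNReal.ofReal_lt_ofReal_iff_of_nonneg (le_of_lt hl0)).2 hx
        refine (measure_mono hsub).trans ?_
        rw [Real.volume_Icc, sub_zero, ENNReal.ofReal_toReal h]

theorem ofReal_mul_maximalRearrangement (f : Ω →ₘ[μ] 𝕜) {t : ℝ} (ht : 0 < t) :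
    ENNReal.ofReal t * maximalRearrangement f t = ∫⁻ u in Ioo 0 t, rearrangement f u := by
  rw [maximalRearrangement, ← mul_assoc,
    ENNReal.mul_inv_cancel (by simpa using ht) ENNReal.ofReal_ne_top, one_mul]

theorem ofReal_mul_rearrangement_le_lintegral (f : Ω →ₘ[μ] 𝕜) (t : ℝ) :
    ENNReal.ofReal t * rearrangement f t ≤ ∫⁻ u in Ioo 0 t, rearrangement f u := by
  calc _ = ∫⁻ _ in Ioo 0 t, rearrangement f t := by
        rw [setLIntegral_const, Real.volume_Ioo, sub_zero, mul_comm]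
    _ ≤ _ := setLIntegral_mono' measurableSet_Ioo fun u hu => rearrangement_antitone f hu.2.le

/-- Splitting `f` at the height `f*(t)`. -/
theorem exists_decomposition (f : Ω →ₘ[μ] 𝕜) (t : ℝ) :
    ∃ f₀ f₁ : Ω →ₘ[μ] 𝕜, f = f₀ + f₁ ∧
      eLpNorm f₀ 1 μ ≤ ∫⁻ u in Ioo 0 t, rearrangement f u ∧
      eLpNorm f₁ ∞ μ ≤ rearrangement f t := by
  set E : Set Ω := {x | rearrangement f t < ‖f x‖ₑ} with hE
  have hEm : MeasurableSet E := measurableSet_lt measurable_const f.stronglyMeasurable.enorm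
  have h₀ : AEStronglyMeasurable (E.indicator f) μ := f.aestronglyMeasurable.indicator hEm
  have h₁ : AEStronglyMeasurable (Eᶜ.indicator f) μ := f.aestronglyMeasurable.indicator hEm.compl
  refine ⟨AEEqFun.mk _ h₀, AEEqFun.mk _ h₁, ?_, ?_, ?_⟩
  · simp only [AEEqFun.mk_add_mk, indicator_self_add_compl, AEEqFun.mk_coeFn]
  · rw [eLpNorm_congr_ae (AEEqFun.coeFn_mk _ h₀), eLpNorm_one_eq_lintegral_enorm]
    simp_rw [enorm_indicator_eq_indicator_enorm]
    rw [lintegral_indicator hEm]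
    exact setLIntegral_enorm_le f (measure_rearrangement_lt_le f t)
  · rw [eLpNorm_congr_ae (AEEqFun.coeFn_mk _ h₁), eLpNorm_exponent_top]
    refine eLpNormEssSup_le_of_ae_enorm_bound (ae_of_all _ fun x => ?_)
    by_cases hx : x ∈ E
    · simp [hx]
    · rw [indicator_of_mem (by exact hx)]
      exact not_lt.1 hx

theorem exists_decomposition_mem (f : Ω →ₘ[μ] 𝕜) {t : ℝ} (ht : 0 < t)
    (hf : maximalRearrangement f t ≠ ∞) :
    ∃ f₀ ∈ (lebesgueSpace μ 𝕜 1).elements, ∃ f₁ ∈ (lebesgueSpace μ 𝕜 ∞).elements, f = f₀ + f₁ ∧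
      eLpNorm f₀ 1 μ + ENNReal.ofReal t * eLpNorm f₁ ∞ μ
        ≤ 2 * (ENNReal.ofReal t * maximalRearrangement f t) := by
  obtain ⟨f₀, f₁, h, h₀, h₁⟩ := exists_decomposition f t
  have h₁' := (mul_le_mul_right h₁ (ENNReal.ofReal t)).trans
    (ofReal_mul_rearrangement_le_lintegral f t)
  rw [← ofReal_mul_maximalRearrangement f ht] at h₀ h₁'
  have hfin : ENNReal.ofReal t * maximalRearrangement f t < ∞ :=
    ENNReal.mul_lt_top ENNReal.ofReal_lt_top hf.lt_top
  refine ⟨f₀, h₀.trans_lt hfin, f₁, ?_, h, ?_⟩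
  · exact ENNReal.lt_top_of_mul_ne_top_right (h₁'.trans_lt hfin).ne (by simpa using ht)
  · rw [two_mul]
    exact add_le_add h₀ h₁'

theorem peetreK_le_two_mul (f : Ω →ₘ[μ] 𝕜) {t : ℝ} (ht : 0 < t) :
    peetreK (lebesgueSpace μ 𝕜 1) (lebesgueSpace μ 𝕜 ∞) f t
      ≤ 2 * (ENNReal.ofReal t * maximalRearrangement f t) := by
  rcases eq_or_ne (maximalRearrangement f t) ∞ with h | h
  · have ht' : ENNReal.ofReal t ≠ 0 := by simpa using ht
    simp [h, ENNReal.mul_top ht', ENNReal.mul_top]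
  obtain ⟨f₀, h₀, f₁, h₁, hf, hle⟩ := exists_decomposition_mem f ht h
  exact (iInf_le_of_le f₀ <| iInf_le_of_le h₀ <| iInf_le_of_le f₁ <| iInf_le_of_le h₁ <|
    iInf_le_of_le hf le_rfl).trans hle

theorem maximalRearrangement_le_tsum (f : Ω →ₘ[μ] 𝕜) {t : ℝ} (ht : 0 < t) :
    maximalRearrangement f t
      ≤ ∑' k : ℕ, ENNReal.ofReal ((1 / 2) ^ (k + 1)) * rearrangement f ((1 / 2) ^ (k + 1) * t) := by
  have hcover : Ioo 0 t ⊆ ⋃ k : ℕ, Ioc ((1 / 2 : ℝ) ^ (k + 1) * t) ((1 / 2 : ℝ) ^ k * t) := by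
    rintro u ⟨hu0, hut⟩
    -- This k satisfies 2^{-(k+1)} < u/t ≤ 2^{-k}. On that piece f* is at most its value at the left
    -- endpoint, and the piece has length 2^{-(k+1)} t.
    obtain ⟨k, hk, hk'⟩ := exists_nat_pow_near_of_lt_one (div_pos hu0 ht) ((div_le_one ht).2 hut.le)
      (by norm_num : (0 : ℝ) < 1 / 2) (by norm_num)
    exact mem_iUnion.2 ⟨k, (lt_div_iff₀ ht).1 hk, (div_le_iff₀ ht).1 hk'⟩
  have hterm : ∀ k : ℕ, ∫⁻ u in Ioc ((1 / 2 : ℝ) ^ (k + 1) * t) ((1 / 2 : ℝ) ^ k * t),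
      rearrangement f u ≤ ENNReal.ofReal t *
        (ENNReal.ofReal ((1 / 2) ^ (k + 1)) * rearrangement f ((1 / 2) ^ (k + 1) * t)) := fun k => by
    calc _ ≤ ∫⁻ _ in Ioc ((1 / 2 : ℝ) ^ (k + 1) * t) ((1 / 2 : ℝ) ^ k * t),
          rearrangement f ((1 / 2) ^ (k + 1) * t) :=
          setLIntegral_mono' measurableSet_Ioc fun u hu => rearrangement_antitone f hu.1.le
      _ = _ := by
          rw [setLIntegral_const, Real.volume_Ioc, ← mul_assoc, ← ENNReal.ofReal_mul ht.le, mul_comm]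
          congr 2
          rw [pow_succ]; ring
  calc maximalRearrangement f t
      ≤ (ENNReal.ofReal t)⁻¹ * ∑' k : ℕ, ENNReal.ofReal t *
        (ENNReal.ofReal ((1 / 2) ^ (k + 1)) * rearrangement f ((1 / 2) ^ (k + 1) * t)) := by
        rw [maximalRearrangement]
        gcongr
        exact ((lintegral_mono_set hcover).trans (lintegral_iUnion_le _ _)).trans
          (ENNReal.tsum_le_tsum hterm)
    _ = _ := by
        rw [ENNReal.tsum_mul_left, ← mul_assoc,
          ENNReal.inv_mul_cancel (by simpa using ht) ENNReal.ofReal_ne_top, one_mul]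

end

/-! ### The cycle of embeddings -/

theorem Space.Embeds.trans {E : Type*} {X Y Z : Space E} (h : X.Embeds Y) (h' : Y.Embeds Z) :
    X.Embeds Z := by
  obtain ⟨hs, C, hC⟩ := h
  obtain ⟨hs', C', hC'⟩ := h'
  refine ⟨hs.trans hs', C' * C, fun f hf => (hC' f (hs hf)).trans ?_⟩
  rw [ENNReal.coe_mul, mul_assoc]
  gcongr
  exact hC f hf

/-- The cycle reaches the f* space `Z` before the f** space `W`, while the chain of equalities lists
f** first; hence the order in the conclusion. -/
theorem Space.same_of_embeds_cycle {E : Type*} {X Y Z W : Space E} (h₁ : X.Embeds Y)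
    (h₂ : Y.Embeds Z) (h₃ : Z.Embeds W) (h₄ : W.Embeds X) :
    X.Same Y ∧ Y.Same W ∧ W.Same Z :=
  ⟨⟨h₁, (h₂.trans h₃).trans h₄⟩, ⟨h₂.trans h₃, h₄.trans h₁⟩, ⟨(h₄.trans h₁).trans h₂, h₃⟩⟩

section

variable {Ω : Type*} [MeasurableSpace Ω] (μ : Measure Ω) (𝕜 : Type*) [RCLike 𝕜]

/-- The interpolation space built on `nestedNorm J`. -/
noncomputable def interpNested (J : ℝ → Set ℝ) (A₀ A₁ : Space (Ω →ₘ[μ] 𝕜)) (θ : ℝ) (s : ℝ≥0∞)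
    (c : ℝ → ℝ) (r : ℝ≥0∞) (b : ℝ → ℝ) (q : ℝ≥0∞) (a : ℝ → ℝ) : Space (Ω →ₘ[μ] 𝕜) where
  elements := {f | f ∈ sumElements A₀ A₁ ∧ nestedNorm J (-θ) s c r b q a (peetreK A₀ A₁ f) < ∞}
  qnorm f := nestedNorm J (-θ) s c r b q a (peetreK A₀ A₁ f)

theorem same_of_isDilationFamily {J : ℝ → Set ℝ} (hJ : IsDilationFamily J) {θ : ℝ} (hθ : 0 < θ)
    {q r s : ℝ≥0∞} (hq : 0 < q) (hr : 0 < r) (hs : 0 < s) {a b c : ℝ → ℝ}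
    (ha : SlowlyVarying a) (hb : SlowlyVarying b) (hc : SlowlyVarying c) :
    (interpNested μ 𝕜 J (lebesgueSpace μ 𝕜 1) (lebesgueSpace μ 𝕜 ∞) θ s c r b q a).Same
      (interpNested μ 𝕜 J (weakL1 μ 𝕜) (lebesgueSpace μ 𝕜 ∞) θ s c r b q a) ∧
    (interpNested μ 𝕜 J (weakL1 μ 𝕜) (lebesgueSpace μ 𝕜 ∞) θ s c r b q a).Same
      (Space.ofFunctional fun f : Ω →ₘ[μ] 𝕜 =>
        nestedNorm J (1 - θ) s c r b q a (maximalRearrangement f)) ∧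
    (Space.ofFunctional fun f : Ω →ₘ[μ] 𝕜 =>
        nestedNorm J (1 - θ) s c r b q a (maximalRearrangement f)).Same
      (Space.ofFunctional fun f : Ω →ₘ[μ] 𝕜 =>
        nestedNorm J (1 - θ) s c r b q a (rearrangement f)) := by
  have hθ' : -θ + 1 = 1 - θ := by ring
  refine Space.same_of_embeds_cycle ?_ ?_ ?_ ?_
  · have key : ∀ f : Ω →ₘ[μ] 𝕜, nestedNorm J (-θ) s c r b q a
        (peetreK (weakL1 μ 𝕜) (lebesgueSpace μ 𝕜 ∞) f) ≤ nestedNorm J (-θ) s c r b q a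
        (peetreK (lebesgueSpace μ 𝕜 1) (lebesgueSpace μ 𝕜 ∞) f) := fun f =>
      hJ.nestedNorm_mono fun t _ => peetreK_weakL1_le _ f t
    refine ⟨?_, 1, fun f _ => by simpa using! key f⟩
    rintro f ⟨⟨f₀, h₀, f₁, h₁, h⟩, hf⟩
    exact ⟨⟨f₀, lebesgueSpace_one_subset_weakL1 h₀, f₁, h₁, h⟩, (key f).trans_lt hf⟩
  · have key : ∀ f : Ω →ₘ[μ] 𝕜, nestedNorm J (1 - θ) s c r b q a (rearrangement f)
        ≤ nestedNorm J (-θ) s c r b q a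
          (peetreK (weakL1 μ 𝕜) (lebesgueSpace μ 𝕜 ∞) f) := fun f => by
      rw [← hθ', ← hJ.nestedNorm_ofReal_mul]
      exact hJ.nestedNorm_mono fun t ht => ofReal_mul_rearrangement_le_peetreK f ht
    exact ⟨fun f hf => (key f).trans_lt hf.2, 1, fun f _ => by simpa using! key f⟩
  · obtain ⟨C, hC⟩ := hJ.exists_nestedNorm_dyadic_le hq hr hs ha hb hc
      (show 1 - θ < 1 by linarith)
    have key : ∀ f : Ω →ₘ[μ] 𝕜, nestedNorm J (1 - θ) s c r b q a (maximalRearrangement f)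
        ≤ C * nestedNorm J (1 - θ) s c r b q a (rearrangement f) := fun f =>
      (hJ.nestedNorm_mono fun t ht => maximalRearrangement_le_tsum f ht).trans
        (hC _ (rearrangement_antitone f).measurable)
    exact ⟨fun f hf => (key f).trans_lt (ENNReal.mul_lt_top ENNReal.coe_lt_top hf), C,
      fun f _ => key f⟩
  · have key : ∀ f : Ω →ₘ[μ] 𝕜, nestedNorm J (-θ) s c r b q a
        (peetreK (lebesgueSpace μ 𝕜 1) (lebesgueSpace μ 𝕜 ∞) f)
        ≤ (2 : ℝ≥0) * nestedNorm J (1 - θ) s c r b q a (maximalRearrangement f) := fun f => by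
      rw [← hθ', ← hJ.nestedNorm_ofReal_mul]
      exact (hJ.nestedNorm_mono fun t ht => peetreK_le_two_mul f ht).trans
        (hJ.nestedNorm_const_mul_le 2 _)
    refine ⟨fun f hf => ⟨?_, (key f).trans_lt (ENNReal.mul_lt_top ENNReal.coe_lt_top hf)⟩, 2,
      fun f _ => key f⟩
    -- Membership in L_1 + L_∞ needs an argument of its own, because finiteness of the norm of the
    -- K-functional is a separate requirement.
    obtain ⟨t, ht, hft⟩ := hJ.exists_ne_top hq hr hs ha hb hc hf
    obtain ⟨f₀, h₀, f₁, h₁, h, -⟩ := exists_decomposition_mem f ht hft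
    exact ⟨f₀, h₀, f₁, h₁, h⟩

end

end LorentzKaramata

theorem theorem6p5 {Ω : Type*} [MeasurableSpace Ω] (μ : Measure Ω) [SigmaFinite μ]
    (hμ : LorentzKaramata.Nonatomic μ) (𝕜 : Type*) [RCLike 𝕜]
    (θ : ℝ) (hθ₀ : 0 < θ) (hθ₁ : θ ≤ 1) (p : ℝ≥0∞) (hp : p = 1 / ENNReal.ofReal (1 - θ))
    (q r s : ℝ≥0∞) (hq : 0 < q) (hr : 0 < r) (hs : 0 < s)
    (a b c : ℝ → ℝ) (ha : LorentzKaramata.SlowlyVarying a)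
    (hb : LorentzKaramata.SlowlyVarying b) (hc : LorentzKaramata.SlowlyVarying c) :
    ((LorentzKaramata.interpLL (LorentzKaramata.lebesgueSpace μ 𝕜 1)
          (LorentzKaramata.lebesgueSpace μ 𝕜 ∞) θ s c r b q a).Same
        (LorentzKaramata.interpLL (LorentzKaramata.weakL1 μ 𝕜)
          (LorentzKaramata.lebesgueSpace μ 𝕜 ∞) θ s c r b q a) ∧
      (LorentzKaramata.interpLL (LorentzKaramata.weakL1 μ 𝕜)
          (LorentzKaramata.lebesgueSpace μ 𝕜 ∞) θ s c r b q a).Same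
        (LorentzKaramata.lorentzMaxLL μ 𝕜 p s c r b q a) ∧
      (LorentzKaramata.lorentzMaxLL μ 𝕜 p s c r b q a).Same
        (LorentzKaramata.lorentzLL μ 𝕜 p s c r b q a)) ∧
    ((LorentzKaramata.interpRR (LorentzKaramata.lebesgueSpace μ 𝕜 1)
          (LorentzKaramata.lebesgueSpace μ 𝕜 ∞) θ s c r b q a).Same
        (LorentzKaramata.interpRR (LorentzKaramata.weakL1 μ 𝕜)
          (LorentzKaramata.lebesgueSpace μ 𝕜 ∞) θ s c r b q a) ∧
      (LorentzKaramata.interpRR (LorentzKaramata.weakL1 μ 𝕜)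
          (LorentzKaramata.lebesgueSpace μ 𝕜 ∞) θ s c r b q a).Same
        (LorentzKaramata.lorentzMaxRR μ 𝕜 p s c r b q a) ∧
      (LorentzKaramata.lorentzMaxRR μ 𝕜 p s c r b q a).Same
        (LorentzKaramata.lorentzRR μ 𝕜 p s c r b q a)) := by
  have hp' : (p⁻¹).toReal = 1 - θ := by
    rw [hp, one_div, inv_inv, ENNReal.toReal_ofReal (by linarith)]
  simp only [LorentzKaramata.lorentzMaxLL, LorentzKaramata.lorentzLL,
    LorentzKaramata.lorentzMaxRR, LorentzKaramata.lorentzRR, hp']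
  -- The LL and RR norms are by definition `nestedNorm` for `Ioo 0` and `Ioi`.
  exact ⟨LorentzKaramata.same_of_isDilationFamily μ 𝕜 LorentzKaramata.isDilationFamily_Ioo hθ₀
      hq hr hs ha hb hc,
    LorentzKaramata.same_of_isDilationFamily μ 𝕜 LorentzKaramata.isDilationFamily_Ioi hθ₀
      hq hr hs ha hb hc⟩
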